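/- Let $\Bbbk$ be an algebraically closed field of characteristic zero, and let $r,w\in\mathbb{N}_+$. A variety is an integral separated scheme of finite type over $\Bbbk$. Let $\pi:C\to S$ be an affine cone of varieties, i.e. an affine morphism of varieties with a grading $\mathcal{A}:=\pi_*\mathcal{O}_C=\bigoplus_{n\ge0}\mathcal{A}_n$ of quasi-coherent $\mathcal{O}_S$-algebras such that $\mathcal{A}_0=\mathcal{O}_S$; the grading is a $\mathbb{G}_m$-action on $C$. Let $Z\subseteq C$ be the zero section, with ideal $\mathcal{A}_{>0}$. Let $\mathbb{G}_a^r$ act on $C$ such that $\pi$ is invariant and such that the two actions form an action of $\mathbb{G}_a^r\rtimes_w\mathbb{G}_m$, where $\mathbb{G}_m$ acts on $\mathfrak{u}:=\mathrm{Lie}(\mathbb{G}_a^r)$ by scalar multiplication with weight $w$. Let $\mathcal{Q}(\pi)$ be the cokernel of the map $\Omega_{\mathcal{A}/\mathcal{A}_0}\to\mathfrak{u}^*\otimes\mathcal{A}$, $\mathrm{d}f\mapsto\sum_i u_i\otimes(\xi_i.f)$, where $\xi_1,\dots,\xi_r$ and $u_1,\dots,u_r$ are dual bases of $\mathfrak{u}$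 and $\mathfrak{u}^*$, and let $\mathrm{Fit}_m$ denote its $m$-th Fitting ideal. Put $$d(\pi):=\min_{z\in Z}\dim\mathrm{Stab}_{\mathfrak{u}}(z),\qquad e(\pi):=\min\{n\in\mathbb{N}:\mathrm{Fit}_{d(\pi)-1}(\mathcal{Q}(\pi))\cap\mathcal{A}_n\neq0\},$$ where $z$ runs over closed points and $e(\pi):=\infty$ if $\mathrm{Fit}_{d(\pi)-1}(\mathcal{Q}(\pi))=0$. Indices $(d,e)$ are compared lexicographically. Let $\mathcal{I}:=\mathrm{Fit}_{d(\pi)}(\mathcal{Q}(\pi))+\mathcal{A}_{>0}$, which is the ideal of the locus in $Z$ where $\dim\mathrm{Stab}_{\mathfrak{u}}>d(\pi)$, and let $\mathcal{J}:=\ker\big(\mathcal{A}\to\mathcal{O}(\mathbb{G}_a^r)\otimes\mathcal{A}/\mathcal{I}\big)$, the ideal of the closure of the $\mathbb{G}_a^r$-sweep of that locus. Let $\pi':C'\to S'$ be the result of Modification I, i.e. the modification of $\pi$ along $\mathcal{J}$: $C'$ is the open stratum of the Białynicki-Birula stratification (with respect to limits as $t\to0$) for the induced $\mathbb{G}_m$-action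 on the blow-up $\mathrm{Bl}_{\mathcal{J}}(C)$, and $\pi'$ is again an affine cone of varieties with an action of $\mathbb{G}_a^r\rtimes_w\mathbb{G}_m$ as above, such that $p:C'\to C$ is equivariant and there is $q:S'\to S$ with $\pi\circ p=q\circ\pi'$. Then $$(d(\pi'),e(\pi'))\le(d(\pi),e(\pi)),$$ and in fact equality holds. -/

import Mathlib

open CategoryTheory AlgebraicGeometry Opposite

universe u

noncomputable section

namespace GradedAdditive

/-- `X` is a variety over the field `k`: an integral scheme (reduced, irreducible, non-empty),
separated and of finite type over `k`. -/
structure IsVariety {k : Type u} [Field k] {X : Scheme.{u}}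
    (f : X ⟶ Spec (CommRingCat.of k)) : Prop where
  isIntegral : IsIntegral X
  isSeparated : IsSeparated f
  locallyOfFiniteType : LocallyOfFiniteType f
  quasiCompact : QuasiCompact f

/-- An affine cone of varieties `π : C ⟶ S` over `k`: an affine morphism, together with an
`ℕ`-grading of the `𝒪_S`-algebra `𝒜 = π_* 𝒪_C` whose degree zero part is `𝒪_S`.  The grading is
given on all affine opens of `S`, compatibly with restriction; since elements of `𝒪_S` have degree
zero, the graded pieces are then automatically quasi-coherent `𝒪_S`-modules. -/
structure AffineCone (k : Type u) [Field k] where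
  C : Scheme.{u}
  S : Scheme.{u}
  π : C ⟶ S
  /-- the structure morphism of the base -/
  str : S ⟶ Spec (CommRingCat.of k)
  isAffineHom : IsAffineHom π
  isVariety_base : IsVariety str
  isVariety_total : IsVariety (π ≫ str)
  /-- the graded pieces `𝒜_n(U)` -/
  gr : (U : S.affineOpens) → ℕ → AddSubgroup Γ(C, π ⁻¹ᵁ U.1)
  gradedRing : ∀ U, GradedRing (gr U)
  map_mem_gr : ∀ {U V : S.affineOpens} (h : π ⁻¹ᵁ U.1 ≤ π ⁻¹ᵁ V.1) {n : ℕ}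
    {f : Γ(C, π ⁻¹ᵁ V.1)}, f ∈ gr V n → (C.presheaf.map (homOfLE h).op).hom f ∈ gr U n
  app_injective : ∀ U : S.affineOpens, Function.Injective (π.app U.1).hom
  mem_gr_zero_iff : ∀ (U : S.affineOpens) (f : Γ(C, π ⁻¹ᵁ U.1)),
    f ∈ gr U 0 ↔ ∃ s : Γ(S, U.1), (π.app U.1).hom s = f

/-- An affine cone of varieties `π : C ⟶ S` over `k` with an action of `𝔾_a^r ⋊_w 𝔾_m`, where
`𝔾_m` acts through the grading and `π` is `𝔾_a^r`-invariant.

As `π` is affine and invariant, the action of `𝔾_a^r = Spec k[u_1, …, u_r]` is given by its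
co-action `𝒜 → 𝒜[u_1, …, u_r]`, `f ↦ ((u, x) ↦ f(u.x))`, a morphism of `𝒪_S`-algebras. -/
structure GradedCone (k : Type u) [Field k] (r w : ℕ) extends AffineCone k where
  coact : (U : S.affineOpens) →
    Γ(C, π ⁻¹ᵁ U.1) →+* MvPolynomial (Fin r) Γ(C, π ⁻¹ᵁ U.1)
  coact_map : ∀ {U V : S.affineOpens} (h : π ⁻¹ᵁ U.1 ≤ π ⁻¹ᵁ V.1) (f : Γ(C, π ⁻¹ᵁ V.1)),
    coact U ((C.presheaf.map (homOfLE h).op).hom f) =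
      MvPolynomial.map (C.presheaf.map (homOfLE h).op).hom (coact V f)
  /-- `π` is invariant: the co-action is `𝒪_S`-linear -/
  coact_base : ∀ (U : S.affineOpens) (s : Γ(S, U.1)),
    coact U ((π.app U.1).hom s) = MvPolynomial.C ((π.app U.1).hom s)
  /-- `0.x = x` -/
  coact_zero : ∀ (U : S.affineOpens) (f : Γ(C, π ⁻¹ᵁ U.1)),
    MvPolynomial.constantCoeff (coact U f) = f
  /-- `u.(v.x) = (u + v).x` -/
  coact_add : ∀ (U : S.affineOpens) (f : Γ(C, π ⁻¹ᵁ U.1)),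
    MvPolynomial.map (coact U) (coact U f) =
      MvPolynomial.eval₂ (MvPolynomial.C.comp MvPolynomial.C)
        (fun i => MvPolynomial.X i + MvPolynomial.C (MvPolynomial.X i)) (coact U f)
  /-- `t.(u.x) = (t^w u).(t.x)` for `t` in `𝔾_m`: the coefficient of a monomial of degree `m` in
  the co-action of a function of degree `n` has degree `n - w m` (and is `0` if `n < w m`) -/
  coact_weight : ∀ (U : S.affineOpens) (n : ℕ) (f : Γ(C, π ⁻¹ᵁ U.1)), f ∈ gr U n →
    ∀ m : Fin r →₀ ℕ, MvPolynomial.coeff m (coact U f) = 0 ∨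
      ∃ j : ℕ, j + w * m.degree = n ∧ MvPolynomial.coeff m (coact U f) ∈ gr U j

/-- The `d`-th Fitting ideal of the cokernel of `φ : N → R^n`, generated by the minors of size
`n - d` of `φ` (it is `R` for `d ≥ n` and `0` for `d < 0`). -/
def fittingIdealCoker {R : Type*} [CommRing R] {N : Type*} [AddCommGroup N] [Module R N]
    {n : ℕ} (φ : N →ₗ[R] (Fin n → R)) (d : ℤ) : Ideal R :=
  Ideal.span {x | ∃ (ω : Fin ((n : ℤ) - d).toNat → N) (c : Fin ((n : ℤ) - d).toNat → Fin n),
    x = (Matrix.of fun i j => φ (ω i) (c j)).det}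

namespace GradedCone

variable {k : Type u} [Field k] {r w : ℕ} (X : GradedCone k r w)

/-- The algebra `𝒜(U)` of functions on `C` over an affine open `U` of `S`. -/
abbrev A (U : X.S.affineOpens) : Type u := Γ(X.C, X.π ⁻¹ᵁ U.1)

instance algebraBase (U : X.S.affineOpens) : Algebra Γ(X.S, U.1) (X.A U) :=
  (X.π.app U.1).hom.toAlgebra

/-- The derivation `f ↦ (ξ_1.f, …, ξ_r.f)` of `𝒜(U)` over `𝒜_0(U)`, where `ξ_i.f` is the
coefficient of `u_i` in the co-action of `f`; these `ξ_i` give the infinitesimal action of the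
standard basis of `𝔲 = Lie(𝔾_a^r) = k^r`. -/
def xi (U : X.S.affineOpens) : Derivation Γ(X.S, U.1) (X.A U) (Fin r → X.A U) :=
  Derivation.mk'
    { toFun := fun f i => MvPolynomial.coeff (Finsupp.single i 1) (X.coact U f)
      map_add' := fun f g => by ext i; simp
      map_smul' := fun s f => by
        ext i
        simp [Algebra.smul_def, RingHom.algebraMap_toAlgebra, X.coact_base] }
    (fun f g => by
      ext i
      have hc := X.coact_zero U
      simp only [MvPolynomial.constantCoeff_eq] at hc
      simp only [LinearMap.coe_mk, AddHom.coe_mk, map_mul, MvPolynomial.coeff_mul,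
        Pi.add_apply, Pi.smul_apply, smul_eq_mul]
      rw [Finsupp.antidiagonal_single, Finset.sum_map, Finset.Nat.antidiagonal_succ]
      simp [hc]
      ring)

/-- The morphism `Ω_{𝒜/𝒜_0} → 𝔲^* ⊗ 𝒜 = 𝒜^r`, `df ↦ ∑ u_i ⊗ ξ_i.f`, whose cokernel is
`𝒬(π)`. -/
def conormalMap (U : X.S.affineOpens) :
    Ω[X.A U⁄Γ(X.S, U.1)] →ₗ[X.A U] (Fin r → X.A U) :=
  (X.xi U).liftKaehlerDifferential

/-- The Fitting ideal `Fit_d(𝒬(π))` over the affine open `U`. -/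
def Fit (U : X.S.affineOpens) (d : ℤ) : Ideal (X.A U) :=
  fittingIdealCoker (X.conormalMap U) d

/-- The constants `k → 𝒜(U)`. -/
def const (U : X.S.affineOpens) : k →+* X.A U :=
  ((Scheme.ΓSpecIso (CommRingCat.of k)).inv ≫
    (X.π ≫ X.str).appLE ⊤ (X.π ⁻¹ᵁ U.1) (by simp)).hom

/-- The Lie algebra stabiliser `Stab_𝔲(x)` of a (closed) point `x` of `C`: those `∑ c_i ξ_i` in
`𝔲 = k^r` whose vector field vanishes at `x`. -/
def stab (x : X.C) : Submodule k (Fin r → k) where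
  carrier := {c | ∀ (U : X.S.affineOpens) (hx : x ∈ X.π ⁻¹ᵁ U.1) (f : X.A U),
    (X.C.evaluation _ x hx).hom (∑ i, X.const U (c i) * X.xi U f i) = 0}
  zero_mem' := fun U hx f => by simp
  add_mem' := fun {a b} ha hb U hx f => by
    have h1 := ha U hx f
    have h2 := hb U hx f
    simp only [Pi.add_apply, map_add, add_mul, Finset.sum_add_distrib] at *
    rw [h1, h2, add_zero]
  smul_mem' := fun c a ha U hx f => by
    have h1 := ha U hx f
    simp only [Pi.smul_apply, smul_eq_mul, map_mul, mul_assoc, ← Finset.mul_sum]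
    rw [h1, mul_zero]

/-- The ideal `𝒜_{>0}` over `U`; it cuts out the zero section `Z` of the cone. -/
def positiveIdeal (U : X.S.affineOpens) : Ideal (X.A U) :=
  Ideal.span {f | ∃ n : ℕ, 0 < n ∧ f ∈ X.gr U n}

/-- The underlying set of the zero section `Z ⊆ C`. -/
def zeroSection : Set X.C :=
  {x | ∀ (U : X.S.affineOpens) (hx : x ∈ X.π ⁻¹ᵁ U.1), ∀ f ∈ X.positiveIdeal U,
    (X.C.evaluation _ x hx).hom f = 0}

/-- `d(π)`: the minimum of `dim Stab_𝔲(z)` over the closed points `z` of `Z`. -/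
def d : ℕ :=
  sInf {m | ∃ z ∈ X.zeroSection, IsClosed {z} ∧ m = Module.finrank k (X.stab z)}

/-- `e(π)`: the minimal `n` with `Fit_{d(π)-1}(𝒬(π)) ∩ 𝒜_n ≠ 0`, and `∞` if there is none, that
is, if `Fit_{d(π)-1}(𝒬(π)) = 0`. -/
def e : ℕ∞ :=
  sInf {N | ∃ n : ℕ, N = n ∧
    ∃ (U : X.S.affineOpens), ∃ f ∈ X.Fit U ((X.d : ℤ) - 1), f ∈ X.gr U n ∧ f ≠ 0}

/-- The index `(d(π), e(π))`, in the lexicographic order. -/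
def index : ℕ ×ₗ ℕ∞ := toLex (X.d, X.e)

/-- The ideal `ℐ = Fit_{d(π)}(𝒬(π)) + 𝒜_{>0}` of `Z ∖ Z^reg`, the closed subscheme of `Z` where
`dim Stab_𝔲` exceeds `d(π)`. -/
def nonRegIdeal (U : X.S.affineOpens) : Ideal (X.A U) :=
  X.Fit U X.d ⊔ X.positiveIdeal U

/-- The ideal `𝒥 = ker (𝒜 → 𝒪(𝔾_a^r) ⊗ 𝒜/ℐ)` of the scheme-theoretic image of
`𝔾_a^r × (Z ∖ Z^reg) → C`, that is, of the closure of `𝔾_a^r.(Z ∖ Z^reg)`. -/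
def centreI (U : X.S.affineOpens) : Ideal (X.A U) :=
  RingHom.ker ((MvPolynomial.map (Ideal.Quotient.mk (X.nonRegIdeal U))).comp (X.coact U))

/-- For `T`-points `x`, `x'` of `C` and an invertible function `t` on `T`: `x' = t.x` for the
`𝔾_m`-action on `C` given by the grading, i.e. `f(x') = t^n f(x)` for local sections `f` of
degree `n`. -/
def IsScaled {T : Scheme.{u}} (t : Γ(T, ⊤)ˣ) (x x' : T ⟶ X.C) : Prop :=
  x' ≫ X.π = x ≫ X.π ∧
  ∀ (U : X.S.affineOpens) (V : T.Opens) (h : V ≤ x ⁻¹ᵁ X.π ⁻¹ᵁ U.1)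
    (h' : V ≤ x' ⁻¹ᵁ X.π ⁻¹ᵁ U.1) (n : ℕ), ∀ f ∈ X.gr U n,
    (x'.appLE _ V h').hom f =
      (T.presheaf.map (homOfLE le_top).op).hom (t : Γ(T, ⊤)) ^ n * (x.appLE _ V h).hom f

variable (J : (U : X.S.affineOpens) → Ideal (X.A U))

/-- The inverse image under `f : T ⟶ C` of the ideal sheaf `J` is invertible: locally on `T` it is
generated by one nonzerodivisor. -/
def PullbackInvertible {T : Scheme.{u}} (f : T ⟶ X.C) : Prop :=
  ∀ t : T, ∃ (V : T.affineOpens) (U : X.S.affineOpens) (h : V.1 ≤ f ⁻¹ᵁ X.π ⁻¹ᵁ U.1)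
    (g : Γ(T, V.1)), t ∈ V.1 ∧ g ∈ nonZeroDivisors Γ(T, V.1) ∧
      (J U).map (f.appLE _ V.1 h).hom = Ideal.span {g}

/-- `b : B ⟶ C` is the blow-up of `C` along `J`: the universal morphism to `C` under which the
inverse image of `J` is invertible. -/
structure IsBlowup {B : Scheme.{u}} (b : B ⟶ X.C) : Prop where
  invertible : X.PullbackInvertible J b
  existsUnique_lift : ∀ {T : Scheme.{u}} (f : T ⟶ X.C), X.PullbackInvertible J f →
    ∃! g : T ⟶ B, g ≫ b = f

end GradedCone

/-- An action of `𝔾_m` on a scheme, through its functor of points. -/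
structure GmAction (B : Scheme.{u}) where
  smul : {T : Scheme.{u}} → Γ(T, ⊤)ˣ → (T ⟶ B) → (T ⟶ B)
  naturality : ∀ {T T' : Scheme.{u}} (f : T' ⟶ T) (t : Γ(T, ⊤)ˣ) (x : T ⟶ B),
    f ≫ smul t x = smul (Units.map f.appTop.hom.toMonoidHom t) (f ≫ x)
  one_smul : ∀ {T : Scheme.{u}} (x : T ⟶ B), smul 1 x = x
  mul_smul : ∀ {T : Scheme.{u}} (s t : Γ(T, ⊤)ˣ) (x : T ⟶ B),
    smul (s * t) x = smul s (smul t x)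

namespace GmAction

variable {k : Type u} [Field k] {B : Scheme.{u}} (γ : GmAction B)

open scoped LaurentPolynomial in
/-- The coordinate function `t` on `𝔾_m = Spec k[t, t⁻¹]`. -/
def coordinate (k : Type u) [Field k] : Γ(Spec (CommRingCat.of k[T;T⁻¹]), ⊤)ˣ :=
  Units.map (Scheme.ΓSpecIso (CommRingCat.of k[T;T⁻¹])).inv.hom.toMonoidHom
    (LaurentPolynomial.isUnit_T (R := k) 1).unit

open scoped LaurentPolynomial in
/-- The constant map `𝔾_m → B` at a `k`-point `x`. -/
def constOrbit (x : Spec (CommRingCat.of k) ⟶ B) : Spec (CommRingCat.of k[T;T⁻¹]) ⟶ B :=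
  Spec.map (CommRingCat.ofHom (algebraMap k k[T;T⁻¹])) ≫ x

open scoped LaurentPolynomial in
/-- The orbit map `𝔾_m → B`, `t ↦ t.x` of a `k`-point `x`. -/
def orbit (x : Spec (CommRingCat.of k) ⟶ B) : Spec (CommRingCat.of k[T;T⁻¹]) ⟶ B :=
  γ.smul (coordinate k) (constOrbit x)

/-- `y` is the limit of `t.x` for `t → 0`: the orbit map of `x` extends to a morphism `𝔸¹ → B`
with value `y` at `0`. -/
def IsLimitPoint (x y : Spec (CommRingCat.of k) ⟶ B) : Prop :=
  ∃ h : Spec (CommRingCat.of (Polynomial k)) ⟶ B,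
    Spec.map (CommRingCat.ofHom (Polynomial.toLaurent (R := k))) ≫ h = γ.orbit x ∧
    Spec.map (CommRingCat.ofHom (Polynomial.constantCoeff (R := k))) ≫ h = y

/-- The set of `𝔾_m`-fixed `k`-points of a `k`-scheme `B`. -/
def fixedPoints (str : B ⟶ Spec (CommRingCat.of k)) : Set B :=
  {z | ∃ y : Spec (CommRingCat.of k) ⟶ B, y ≫ str = 𝟙 _ ∧ γ.orbit y = constOrbit y ∧
    z ∈ Set.range y}

/-- `W` is an open stratum of the Białynicki-Birula stratification of `B`: a non-empty open whose
`k`-points are those with limit for `t → 0` in a given connected component of the fixed locus.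
(If `B` is irreducible, there is at most one.) -/
def IsOpenStratum (str : B ⟶ Spec (CommRingCat.of k)) (W : B.Opens) : Prop :=
  (W : Set B).Nonempty ∧ ∃ z₀ ∈ γ.fixedPoints str,
    ∀ x : Spec (CommRingCat.of k) ⟶ B, x ≫ str = 𝟙 _ →
      (Set.range x ⊆ W ↔ ∃ y : Spec (CommRingCat.of k) ⟶ B, γ.IsLimitPoint x y ∧
        Set.range y ⊆ connectedComponentIn (γ.fixedPoints str) z₀)

end GmAction

/-- The cone `X' = (π' : C' ⟶ S')` is the modification of `X = (π : C ⟶ S)` along the invariant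
closed subscheme of `C` with ideal sheaf `J`: `C'` is the open Białynicki-Birula stratum of the
blow-up `B` of `C` along `J` for the induced `𝔾_m`-action, and the maps `p : C' ⟶ C`, `q : S' ⟶ S`
are compatible with all structures. -/
structure Modification {k : Type u} [Field k] {r w : ℕ} (X X' : GradedCone k r w)
    (J : (U : X.S.affineOpens) → Ideal (X.A U)) where
  B : Scheme.{u}
  b : B ⟶ X.C
  isBlowup : X.IsBlowup J b
  action : GmAction B
  /-- `b` is `𝔾_m`-equivariant -/
  isScaled : ∀ {T : Scheme.{u}} (t : Γ(T, ⊤)ˣ) (x : T ⟶ B),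
    X.IsScaled t (x ≫ b) (action.smul t x ≫ b)
  j : X'.C ⟶ B
  isOpenImmersion : IsOpenImmersion j
  isOpenStratum : action.IsOpenStratum (b ≫ X.π ≫ X.str) j.opensRange
  q : X'.S ⟶ X.S
  q_str : q ≫ X.str = X'.str
  comm : (j ≫ b) ≫ X.π = X'.π ≫ q
  /-- `p = j ≫ b` is `𝔾_m`-equivariant -/
  map_mem_gr : ∀ (U : X.S.affineOpens) (U' : X'.S.affineOpens)
    (h : X'.π ⁻¹ᵁ U'.1 ≤ (j ≫ b) ⁻¹ᵁ X.π ⁻¹ᵁ U.1) (n : ℕ), ∀ f ∈ X.gr U n,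
    ((j ≫ b).appLE _ _ h).hom f ∈ X'.gr U' n
  /-- `p = j ≫ b` is `𝔾_a^r`-equivariant -/
  coact_map : ∀ (U : X.S.affineOpens) (U' : X'.S.affineOpens)
    (h : X'.π ⁻¹ᵁ U'.1 ≤ (j ≫ b) ⁻¹ᵁ X.π ⁻¹ᵁ U.1) (f : X.A U),
    X'.coact U' (((j ≫ b).appLE _ _ h).hom f) =
      MvPolynomial.map ((j ≫ b).appLE _ _ h).hom (X.coact U f)

end GradedAdditive

end

/-!
`Fit_m(𝒬(π))` cuts out the locus where `dim Stab_𝔲 > m`. Along the zero section only functions of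
degree zero survive, and as the `ξ_i` lower degrees by `w`, the degree-zero part of a minor of the
`ξ_i.f_j` is the minor for the components of degree `w` of the `f_j`. Hence `d(π)` is the least `m`
such that `Fit_m(𝒬(π))` has a nonzero element of degree zero, and the index only depends on the
degrees of the nonzero homogeneous elements of the Fitting ideals. These are not affected by
inverting a nonzero function of degree zero, so they can be read off over any non-empty affine open
of `S`.

An element of degree zero of `Fit_{d(π)}(𝒬(π))` makes `ℐ`, hence `𝒥`, trivial over a non-empty open
of `S`. There the blow-up is an isomorphism, so `p : C' ⟶ C` is an open immersion over it. A
function on `C` that is nonzero at a point `p(z')`, with `z'` in the zero section of `C'`, and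
vanishes off the image of `p` can be replaced by its part of degree zero; inverting the latter
identifies the two graded algebras.
-/

namespace GradedAdditive

section Minors

variable {R R' ι ι' κ : Type*} [CommRing R] [CommRing R']

/-- The ideal generated by the `N × N` minors of a matrix; the set `ι` of rows may be infinite, and
repeated rows are allowed since they give the minor `0`. -/
def minorIdeal (M : Matrix ι κ R) (N : ℕ) : Ideal R :=
  Ideal.span {x | ∃ (g : Fin N → ι) (c : Fin N → κ), x = (M.submatrix g c).det}

theorem minorIdeal_mono {M : Matrix ι κ R} {M' : Matrix ι' κ R} (h : ∀ i, ∃ i', M' i' = M i)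
    (N : ℕ) : minorIdeal M N ≤ minorIdeal M' N := by
  choose s hs using h
  refine Ideal.span_mono ?_
  rintro _ ⟨g, c, rfl⟩
  refine ⟨s ∘ g, c, congrArg Matrix.det ?_⟩
  ext i j
  exact (congrFun (hs (g i)) (c j)).symm

theorem map_minorIdeal (φ : R →+* R') (M : Matrix ι κ R) (N : ℕ) :
    (minorIdeal M N).map φ = minorIdeal (M.map φ) N := by
  rw [minorIdeal, minorIdeal, Ideal.map_span]
  congr 1
  ext x
  constructor
  · rintro ⟨_, ⟨g, c, rfl⟩, rfl⟩
    exact ⟨g, c, φ.map_det _⟩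
  · rintro ⟨g, c, rfl⟩
    exact ⟨_, ⟨g, c, rfl⟩, φ.map_det _⟩

theorem fittingIdealCoker_eq_minorIdeal {P : Type*} [AddCommGroup P] [Module R P] {r : ℕ}
    (φ : P →ₗ[R] (Fin r → R)) {D : ι → P} (hD : Submodule.span R (Set.range D) = ⊤) (d : ℤ) :
    fittingIdealCoker φ d = minorIdeal (Matrix.of fun i => φ (D i)) ((r : ℤ) - d).toNat := by
  apply le_antisymm
  · refine Ideal.span_le.2 ?_
    rintro _ ⟨ω, c, rfl⟩
    set I := minorIdeal (Matrix.of fun i => φ (D i)) ((r : ℤ) - d).toNat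
    let minor : MultilinearMap R (fun _ : Fin ((r : ℤ) - d).toNat => P) R :=
      Matrix.detRowAlternating.toMultilinearMap.compLinearMap
        fun _ => (LinearMap.funLeft R R c).comp φ
    -- A minor is multilinear in its rows, so it suffices to take the rows among the generators.
    have hminor : (Submodule.mkQ I).compMultilinearMap minor = 0 :=
      MultilinearMap.ext_of_span_eq_top (g := fun _ => D) (fun _ => hD) fun g =>
        (Submodule.Quotient.mk_eq_zero I).2 (Ideal.subset_span ⟨g, c, rfl⟩)
    exact (Submodule.Quotient.mk_eq_zero I).1 congr($hminor ω)
  · refine Ideal.span_mono ?_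
    rintro _ ⟨g, c, rfl⟩
    exact ⟨D ∘ g, c, rfl⟩

theorem exists_pow_mul_eq_map_of_mem_minorIdeal {φ : R →+* R'} {c : R}
    (hc : ∀ a, ∃ (n : ℕ) (b : R), φ c ^ n * a = φ b) {M : Matrix ι κ R} {M' : Matrix ι' κ R'}
    (hM : ∀ i', ∃ (n : ℕ) (i : ι), ∀ j, φ c ^ n * M' i' j = φ (M i j)) {N : ℕ} {x : R'}
    (hx : x ∈ minorIdeal M' N) : ∃ n, ∃ y ∈ minorIdeal M N, φ c ^ n * x = φ y := by
  induction hx using Submodule.span_induction with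
  | mem x hx =>
    obtain ⟨g, s, rfl⟩ := hx
    choose n b hb using fun i => hM (g i)
    refine ⟨∑ i, n i, _, Ideal.subset_span ⟨b, s, rfl⟩, ?_⟩
    rw [φ.map_det, ← Finset.prod_pow_eq_pow_sum, ← Matrix.det_mul_column]
    congr 1
    ext i j
    exact hb i (s j)
  | zero => exact ⟨0, 0, zero_mem _, by simp⟩
  | add x y _ _ hx hy =>
    obtain ⟨n, a, ha, hxa⟩ := hx
    obtain ⟨m, b, hb, hyb⟩ := hy
    refine ⟨n + m, c ^ m * a + c ^ n * b,
      add_mem (Ideal.mul_mem_left _ _ ha) (Ideal.mul_mem_left _ _ hb), ?_⟩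
    rw [map_add, map_mul, map_mul, ← hxa, ← hyb, map_pow, map_pow]
    ring
  | smul a x _ hx =>
    obtain ⟨n, b, hb, hxb⟩ := hx
    obtain ⟨m, a', ha'⟩ := hc a
    refine ⟨m + n, a' * b, Ideal.mul_mem_left _ _ hb, ?_⟩
    rw [map_mul, ← ha', ← hxb, smul_eq_mul]
    ring

variable {K : Type*} [Field K]

theorem exists_linearIndependent_fin {V : Type*} [AddCommGroup V] [Module K V]
    [Module.Finite K V] (v : ι → V) {N : ℕ}
    (h : N ≤ Module.finrank K (Submodule.span K (Set.range v))) :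
    ∃ g : Fin N → ι, LinearIndependent K (v ∘ g) := by
  obtain ⟨f, hf, -, hli⟩ := Submodule.exists_fun_fin_finrank_span_eq K (Set.range v)
  choose g hg using hf
  refine ⟨g ∘ Fin.castLE h, ?_⟩
  convert hli.comp _ (Fin.castLE_injective h)
  exact funext fun i => hg _

theorem minorIdeal_ne_bot_iff [Finite κ] (M : Matrix ι κ K) (N : ℕ) :
    minorIdeal M N ≠ ⊥ ↔ N ≤ Module.finrank K (Submodule.span K (Set.range M.row)) := by
  have := Fintype.ofFinite κ
  rw [ne_eq, minorIdeal, Ideal.span_eq_bot]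
  push Not
  constructor
  · rintro ⟨_, ⟨g, c, rfl⟩, h⟩
    have hli : LinearIndependent K (M.row ∘ g) :=
      .of_comp (LinearMap.funLeft K K c) (Matrix.linearIndependent_rows_of_det_ne_zero h)
    calc N = Module.finrank K (Submodule.span K (Set.range (M.row ∘ g))) := by
          rw [finrank_span_eq_card hli, Fintype.card_fin]
      _ ≤ _ := Submodule.finrank_mono (Submodule.span_mono (Set.range_comp_subset_range g M.row))
  · intro h
    obtain ⟨g, hg⟩ := exists_linearIndependent_fin M.row h
    have hrank : (M.submatrix g id).rank = N := by
      simpa using LinearIndependent.rank_matrix (M := M.submatrix g id) hg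
    rw [Matrix.rank_eq_finrank_span_cols] at hrank
    obtain ⟨c, hc⟩ := exists_linearIndependent_fin (M.submatrix g id).col hrank.ge
    have hunit : IsUnit (M.submatrix g c) := Matrix.linearIndependent_cols_iff_isUnit.1 hc
    exact ⟨_, ⟨g, c, rfl⟩, ((Matrix.isUnit_iff_isUnit_det _).1 hunit).ne_zero⟩

theorem finrank_span_row_add_finrank_eq_card [Fintype κ] (M : Matrix ι κ K)
    (S : Submodule K (κ → K)) (hS : ∀ c, c ∈ S ↔ ∀ i, M i ⬝ᵥ c = 0) :
    Module.finrank K (Submodule.span K (Set.range M.row)) + Module.finrank K S =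
      Fintype.card κ := by
  classical
  let e := dotProductEquiv K κ
  let W := (Submodule.span K (Set.range M.row)).map e.toLinearMap
  have hSW : S = W.dualCoannihilator := by
    apply SetLike.coe_injective
    simp only [W]
    rw [Submodule.map_span, Submodule.coe_dualCoannihilator_span]
    ext c
    rw [SetLike.mem_coe, hS, Set.mem_ofPred_eq, Set.forall_mem_image, Set.forall_mem_range]
    rfl
  have h := Subspace.finrank_add_finrank_dualCoannihilator_eq W
  rwa [← hSW, LinearEquiv.finrank_map_eq, Module.finrank_fintype_fun_eq_card] at h

end Minors

section Graded

variable {A B σ τ : Type*} [CommRing A] [CommRing B] [SetLike σ A] [AddSubgroupClass σ A]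
  [SetLike τ B] [AddSubgroupClass τ B] {𝒜 : ℕ → σ} {ℬ : ℕ → τ} [GradedRing 𝒜] [GradedRing ℬ]

open DirectSum GradedRing

theorem mem_of_map_mem {φ : 𝒜 →+*ᵍ ℬ} (hφ : Function.Injective φ) {n : ℕ} {a : A}
    (h : φ a ∈ ℬ n) : a ∈ 𝒜 n := by
  have ha : (decompose 𝒜 a n : A) = a := hφ <| by
    rw [φ.map_directSumDecompose, decompose_of_mem_same ℬ h]
  exact ha ▸ SetLike.coe_mem _

theorem map_projZeroRingHom (φ : 𝒜 →+*ᵍ ℬ) (a : A) :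
    φ (projZeroRingHom 𝒜 a) = projZeroRingHom ℬ (φ a) :=
  φ.map_directSumDecompose

theorem projZeroRingHom_mem (a : A) : projZeroRingHom 𝒜 a ∈ 𝒜 0 := SetLike.coe_mem _

theorem projZeroRingHom_of_mem {a : A} (ha : a ∈ 𝒜 0) : projZeroRingHom 𝒜 a = a :=
  decompose_of_mem_same 𝒜 ha

theorem exists_mem_pow_projZeroRingHom_mul_eq {φ : 𝒜 →+*ᵍ ℬ} {c b : A} {N n : ℕ} {a : B}
    (h : φ c ^ N * a = φ b) (ha : a ∈ ℬ n) :
    ∃ b' ∈ 𝒜 n, φ (projZeroRingHom 𝒜 c) ^ N * a = φ b' := by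
  refine ⟨decompose 𝒜 b n, SetLike.coe_mem _, ?_⟩
  have hdec := coe_decompose_mul_add_of_right_mem ℬ (i := 0) (a := φ c ^ N) ha
  rw [zero_add] at hdec
  rw [φ.map_directSumDecompose, ← h, hdec, map_projZeroRingHom, ← map_pow]
  rfl

theorem exists_pow_projZeroRingHom_mul_eq {φ : 𝒜 →+*ᵍ ℬ} {c : A}
    (hc : ∀ a, ∃ (N : ℕ) (b : A), φ c ^ N * a = φ b) (a : B) :
    ∃ (N : ℕ) (b : A), φ (projZeroRingHom 𝒜 c) ^ N * a = φ b := by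
  induction a using DirectSum.Decomposition.inductionOn ℬ with
  | zero => exact ⟨0, 0, by simp⟩
  | @homogeneous n a =>
    obtain ⟨N, b, h⟩ := hc a
    obtain ⟨b', -, h'⟩ := exists_mem_pow_projZeroRingHom_mul_eq h a.2
    exact ⟨N, b', h'⟩
  | add x y hx hy =>
    obtain ⟨N, b, h⟩ := hx
    obtain ⟨N', b', h'⟩ := hy
    refine ⟨N + N', projZeroRingHom 𝒜 c ^ N' * b + projZeroRingHom 𝒜 c ^ N * b', ?_⟩
    rw [map_add, map_mul, map_mul, ← h, ← h', map_pow, map_pow]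
    ring

variable (𝒜) in
/-- The degrees of the nonzero homogeneous elements of an ideal of a graded ring. -/
def degreeSet (I : Ideal A) : Set ℕ := {n | ∃ f ∈ I, f ∈ 𝒜 n ∧ f ≠ 0}

theorem degreeSet_eq_of_injective [IsDomain B] {φ : 𝒜 →+*ᵍ ℬ} (hφ : Function.Injective φ)
    {c : A} (hc : c ∈ 𝒜 0) (hc0 : c ≠ 0) {I : Ideal A} {I' : Ideal B}
    (hle : I.map φ.toRingHom ≤ I') (hI' : ∀ x ∈ I', ∃ n, ∃ y ∈ I, φ c ^ n * x = φ y) :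
    degreeSet ℬ I' = degreeSet 𝒜 I := by
  ext n
  constructor
  · rintro ⟨x, hx, hxn, hx0⟩
    obtain ⟨N, y, hy, h⟩ := hI' x hx
    refine ⟨y, hy, mem_of_map_mem hφ ?_, fun hy0 => ?_⟩
    · have hcN : φ c ^ N ∈ ℬ 0 := by
        simpa using SetLike.pow_mem_graded N (φ.map_mem hc)
      simpa [← h] using SetLike.mul_mem_graded hcN hxn
    · rw [hy0, map_zero] at h
      exact mul_ne_zero (pow_ne_zero N ((map_ne_zero_iff φ hφ).2 hc0)) hx0 h
  · rintro ⟨y, hy, hyn, hy0⟩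
    exact ⟨φ y, hle (Ideal.mem_map_of_mem _ hy), φ.map_mem hyn, (map_ne_zero_iff φ hφ).2 hy0⟩

end Graded

section Scheme

variable {X Y : Scheme.{u}}

theorem basicOpen_nonempty_iff [IsReduced X] {U : X.Opens} (f : Γ(X, U)) :
    (X.basicOpen f : Set X).Nonempty ↔ f ≠ 0 := by
  rw [← TopologicalSpace.Opens.ne_bot_iff_nonempty, ne_eq, basicOpen_eq_bot_iff]

theorem basicOpen_inter_zeroLocus_nonempty {U : X.Opens} (hU : IsAffineOpen U)
    {I : Ideal Γ(X, U)} {f : Γ(X, U)} (hf : f ∉ I.radical) :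
    ((X.basicOpen f : Set X) ∩ X.zeroLocus (U := U) I).Nonempty := by
  rw [Ideal.radical_eq_sInf, Submodule.mem_sInf] at hf
  push Not at hf
  obtain ⟨P, ⟨hIP, hP⟩, hfP⟩ := hf
  have mem_basicOpen_iff (g : Γ(X, U)) : hU.fromSpec ⟨P, hP⟩ ∈ X.basicOpen g ↔ g ∉ P := by
    change _ ∈ hU.fromSpec ⁻¹ᵁ X.basicOpen g ↔ _
    rw [hU.fromSpec_preimage_basicOpen]
    rfl
  exact ⟨hU.fromSpec ⟨P, hP⟩, (mem_basicOpen_iff f).2 hfP, (X.mem_zeroLocus_iff _ _).2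
    fun g hg hz => (mem_basicOpen_iff g).1 hz (hIP hg)⟩

theorem basicOpen_inter_nonempty_of_mem_nonZeroDivisors {U : X.Opens} (hU : IsAffineOpen U)
    {g : Γ(X, U)} (hg : g ∈ nonZeroDivisors Γ(X, U)) {W : X.Opens}
    (hW : ((U : Set X) ∩ W).Nonempty) : ((X.basicOpen g : Set X) ∩ W).Nonempty := by
  obtain ⟨x, hxU, hxW⟩ := hW
  obtain ⟨s, hsW, hxs⟩ := hU.exists_basicOpen_le ⟨x, hxW⟩ hxU
  have isNilpotent_iff := Scheme.isNilpotent_iff_basicOpen_eq_bot_of_isCompact hU.isCompact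
  have hne : X.basicOpen (g * s) ≠ ⊥ := fun h0 => by
    obtain ⟨n, hn⟩ := (isNilpotent_iff _).2 h0
    rw [mul_pow, mul_left_mem_nonZeroDivisors_eq_zero_iff (pow_mem hg n)] at hn
    rw [(isNilpotent_iff s).1 ⟨n, hn⟩] at hxs
    exact hxs
  obtain ⟨v, hv⟩ := (TopologicalSpace.Opens.ne_bot_iff_nonempty _).1 hne
  rw [Scheme.basicOpen_mul] at hv
  exact ⟨v, hv.1, hsW hv.2⟩

theorem exists_affineOpens_mem_le {U : X.Opens} {x : X} (hx : x ∈ U) :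
    ∃ V : X.affineOpens, x ∈ V.1 ∧ V.1 ≤ U := by
  obtain ⟨_, ⟨V, hV, rfl⟩, hxV, hVU⟩ := X.isBasis_affineOpens.exists_subset_of_mem_open hx U.2
  exact ⟨⟨V, hV⟩, hxV, hVU⟩

theorem eq_of_eq_affineBasicOpen {α : Sort*} {x : X} (F : ∀ U : X.affineOpens, x ∈ U.1 → α)
    (hF : ∀ U (g : Γ(X, U.1)) hg, F (X.affineBasicOpen g) hg = F U (X.basicOpen_le g hg))
    (U U' : X.affineOpens) (hx : x ∈ U.1) (hx' : x ∈ U'.1) : F U hx = F U' hx' := by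
  obtain ⟨g, g', hgg', hxg⟩ := exists_basicOpen_le_affine_inter U.2 U'.2 x ⟨hx, hx'⟩
  have hbasic : X.affineBasicOpen g = X.affineBasicOpen g' := Subtype.ext hgg'
  have F_congr {V V' : X.affineOpens} (h : V = V') (hxV) : F V hxV = F V' (h ▸ hxV) := by
    subst h
    rfl
  exact (hF U g hxg).symm.trans ((F_congr hbasic hxg).trans (hF U' g' _))

theorem exists_ringHom_of_isClosed_singleton {k : Type u} [Field k] [IsAlgClosed k]
    (f : X ⟶ Spec (CommRingCat.of k)) [LocallyOfFiniteType f] {V : X.Opens} {x : X} (hx : x ∈ V)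
    (hcl : IsClosed {x}) :
    ∃ φ : Γ(X, V) →+* k, (∀ a, φ a ≠ 0 ↔ x ∈ X.basicOpen a) ∧
      ∀ a, φ ((f.appLE ⊤ V (by simp)).hom
        ((Scheme.ΓSpecIso (CommRingCat.of k)).inv.hom a)) = a := by
  let s := pointOfClosedPoint f x hcl
  have hs : ⊤ ≤ s ⁻¹ᵁ V := fun y _ => by simpa [s] using hx
  refine ⟨(s.appLE V ⊤ hs ≫ (Scheme.ΓSpecIso (CommRingCat.of k)).hom).hom, fun a => ?_, fun a => ?_⟩
  · have hnonempty : (((⊤ ⊓ s ⁻¹ᵁ X.basicOpen a :) : (Spec (CommRingCat.of k)).Opens) :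
        Set (Spec (CommRingCat.of k))).Nonempty ↔ x ∈ X.basicOpen a :=
      ⟨fun ⟨y, _, hy⟩ => pointOfClosedPoint_apply f x hcl y ▸ hy, fun hxa =>
        ⟨Classical.arbitrary _, trivial, (congrArg (· ∈ X.basicOpen a)
          (pointOfClosedPoint_apply f x hcl _)).mpr hxa⟩⟩
    rw [← hnonempty, ← Scheme.basicOpen_appLE s ⊤ V hs, basicOpen_nonempty_iff]
    exact map_ne_zero_iff _
      ((ConcreteCategory.isIso_iff_bijective (Scheme.ΓSpecIso (CommRingCat.of k)).hom).1
        inferInstance).1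
  · have hV : V ≤ f ⁻¹ᵁ ⊤ := le_top
    have hsection : f.appLE ⊤ V hV ≫ s.appLE V ⊤ hs = 𝟙 _ := by
      simp only [s, Scheme.Hom.appLE_comp_appLE, pointOfClosedPoint_comp]
      simp only [Scheme.Hom.appLE, Scheme.Hom.id_app]
      exact (Spec (CommRingCat.of k)).presheaf.map_id _
    have hcomp : (Scheme.ΓSpecIso (CommRingCat.of k)).inv ≫ f.appLE ⊤ V hV ≫ s.appLE V ⊤ hs ≫
        (Scheme.ΓSpecIso (CommRingCat.of k)).hom = 𝟙 _ := by
      rw [reassoc_of% hsection, Iso.inv_hom_id]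
    exact congr($(hcomp).hom a)

variable (p : X ⟶ Y) {U : Y.Opens} {V : X.Opens}

theorem isIso_appLE_of_le_opensRange (V : X.Opens) [IsOpenImmersion (V.ι ≫ p)] {D : Y.Opens}
    (hD : D ≤ (V.ι ≫ p).opensRange) {W : X.Opens} (hW : W = V ⊓ p ⁻¹ᵁ D) :
    IsIso (p.appLE D W (hW.trans_le inf_le_right)) := by
  have hpre : V.ι ⁻¹ᵁ W = (V.ι ≫ p) ⁻¹ᵁ D := by
    rw [hW, Scheme.Hom.comp_preimage]
    ext x
    exact ⟨fun hx => hx.2, fun hx => ⟨x.2, hx⟩⟩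
  have hcomp : p.appLE D W (hW.trans_le inf_le_right) ≫ V.ι.app W =
      (V.ι ≫ p).appLE D (V.ι ⁻¹ᵁ W) hpre.le := by
    rw [Scheme.Hom.app_eq_appLE, Scheme.Hom.appLE_comp_appLE]
  have := (V.ι ≫ p).isIso_app D hD
  have := V.ι.isIso_app W (by simpa using hW.trans_le inf_le_left)
  have : IsIso (V.toScheme.presheaf.map (homOfLE hpre.le).op) :=
    inferInstanceAs (IsIso (V.toScheme.presheaf.map (eqToHom hpre).op))
  have : IsIso ((V.ι ≫ p).appLE D (V.ι ⁻¹ᵁ W) hpre.le) :=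
    inferInstanceAs (IsIso (_ ≫ _))
  rw [← hcomp] at this
  exact IsIso.of_isIso_comp_right _ (V.ι.app W)

variable [IsOpenImmersion (V.ι ≫ p)] (h : V ≤ p ⁻¹ᵁ U)

theorem exists_pow_mul_eq_appLE [IsIntegral X] (hU : IsAffineOpen U) {c : Γ(Y, U)}
    (hc : Y.basicOpen c ≤ (V.ι ≫ p).opensRange) (hc0 : (p.appLE U V h).hom c ≠ 0)
    (a : Γ(X, V)) :
    ∃ (N : ℕ) (b : Γ(Y, U)), (p.appLE U V h).hom c ^ N * a = (p.appLE U V h).hom b := by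
  set W := X.basicOpen ((p.appLE U V h).hom c)
  have hW : W = V ⊓ p ⁻¹ᵁ Y.basicOpen c := Scheme.basicOpen_appLE p V U h c
  have hWV : W ≤ V := X.basicOpen_le _
  have hWp : W ≤ p ⁻¹ᵁ Y.basicOpen c := hW.trans_le inf_le_right
  have : Nonempty W := ((basicOpen_nonempty_iff _).2 hc0).coe_sort
  have := isIso_appLE_of_le_opensRange p V hc hW
  obtain ⟨b', hb'⟩ := ((ConcreteCategory.isIso_iff_bijective _).1 this).2
    ((X.presheaf.map (homOfLE hWV).op).hom a)
  have := hU.isLocalization_basicOpen c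
  obtain ⟨N, b, hb⟩ := IsLocalization.Away.surj c b'
  have hcomm (y : Γ(Y, U)) : X.presheaf.map (homOfLE hWV).op ((p.appLE U V h).hom y) =
      p.appLE (Y.basicOpen c) W hWp (algebraMap Γ(Y, U) Γ(Y, Y.basicOpen c) y) := by
    have e : p.appLE U V h ≫ X.presheaf.map (homOfLE hWV).op =
        Y.presheaf.map (homOfLE (Y.basicOpen_le c)).op ≫ p.appLE (Y.basicOpen c) W hWp := by
      rw [Scheme.Hom.map_appLE, Scheme.Hom.appLE_map]
    exact congr($(e).hom y)
  refine ⟨N, b, map_injective_of_isIntegral X (homOfLE hWV) ?_⟩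
  rw [hcomm, ← hb, map_mul, map_mul, map_pow, map_pow, hb', hcomm, mul_comm]

theorem appLE_injective_of_isOpenImmersion [IsIntegral Y] [Nonempty V] :
    Function.Injective (p.appLE U V h).hom := by
  set D := (V.ι ≫ p).opensRange
  have hDU : D ≤ U := by
    rintro _ ⟨x, rfl⟩
    exact h x.2
  have hVD : V ≤ p ⁻¹ᵁ D := fun x hx => ⟨⟨x, hx⟩, rfl⟩
  have : Nonempty D := ⟨⟨_, Classical.arbitrary V, rfl⟩⟩
  have := isIso_appLE_of_le_opensRange p V le_rfl (left_eq_inf.2 hVD)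
  rw [← Scheme.Hom.map_appLE p hVD (homOfLE hDU).op]
  exact ((ConcreteCategory.isIso_iff_bijective _).1 this).1.comp
    (map_injective_of_isIntegral Y (homOfLE hDU))

end Scheme

namespace GradedCone

open GradedRing

variable {k : Type u} [Field k] {r w : ℕ} (X : GradedCone k r w)

instance : AlgebraicGeometry.IsIntegral X.C := X.isVariety_total.isIntegral

instance : AlgebraicGeometry.IsIntegral X.S := X.isVariety_base.isIntegral

instance : IsAffineHom X.π := X.isAffineHom

instance : LocallyOfFiniteType (X.π ≫ X.str) := X.isVariety_total.locallyOfFiniteType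

noncomputable instance (U : X.S.affineOpens) : GradedRing (X.gr U) := X.gradedRing U

instance : JacobsonSpace X.C := LocallyOfFiniteType.jacobsonSpace (X.π ≫ X.str)

variable {X} in
theorem nonempty_of_ne_zero {U : X.S.affineOpens} {f : X.A U} (hf : f ≠ 0) : Nonempty U.1 :=
  have ⟨x, hx⟩ := (basicOpen_nonempty_iff f).2 hf
  ⟨⟨X.π x, X.C.basicOpen_le f hx⟩⟩

instance nonempty_preimage (U : X.S.affineOpens) [Nonempty U.1] : Nonempty (X.π ⁻¹ᵁ U.1) :=
  have hne : (1 : X.A U) ≠ 0 := by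
    rw [← map_one (X.π.app U.1).hom]
    exact (map_ne_zero_iff _ (X.app_injective U)).2 one_ne_zero
  have ⟨x, hx⟩ := (basicOpen_nonempty_iff (1 : X.A U)).2 hne
  ⟨⟨x, X.C.basicOpen_le _ hx⟩⟩

theorem isAffineOpen_preimage (U : X.S.affineOpens) : IsAffineOpen (X.π ⁻¹ᵁ U.1) :=
  U.2.preimage X.π

theorem app_mem_gr_zero {U : X.S.affineOpens} (s : Γ(X.S, U.1)) :
    (X.π.app U.1).hom s ∈ X.gr U 0 :=
  (X.mem_gr_zero_iff U _).2 ⟨s, rfl⟩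

theorem xi_apply (U : X.S.affineOpens) (f : X.A U) (i : Fin r) :
    X.xi U f i = MvPolynomial.coeff (Finsupp.single i 1) (X.coact U f) := rfl

theorem Fit_eq_minorIdeal (U : X.S.affineOpens) (m : ℤ) :
    X.Fit U m = minorIdeal (Matrix.of (X.xi U)) ((r : ℤ) - m).toNat := by
  rw [Fit, fittingIdealCoker_eq_minorIdeal _
    (KaehlerDifferential.span_range_derivation Γ(X.S, U.1) (X.A U))]
  congr 2
  ext1 f
  exact Derivation.liftKaehlerDifferential_comp_D _ f

theorem xi_degree {U : X.S.affineOpens} {n : ℕ} {a : X.A U} (ha : a ∈ X.gr U n) (i : Fin r) :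
    X.xi U a i = 0 ∨ ∃ j, j + w = n ∧ X.xi U a i ∈ X.gr U j := by
  simpa [xi_apply] using X.coact_weight U n a ha (Finsupp.single i 1)

theorem xi_mul_of_mem_gr_zero {U : X.S.affineOpens} {c : X.A U} (hc : c ∈ X.gr U 0) (a : X.A U) :
    X.xi U (c * a) = c • X.xi U a := by
  obtain ⟨s, rfl⟩ := (X.mem_gr_zero_iff U c).1 hc
  rw [Derivation.leibniz, show X.xi U ((X.π.app U.1).hom s) = 0 from (X.xi U).map_algebraMap s,
    smul_zero, add_zero]

theorem projZeroRingHom_xi {U : X.S.affineOpens} (a : X.A U) (i : Fin r) :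
    projZeroRingHom (X.gr U) (X.xi U a i) = X.xi U (proj (X.gr U) w a) i := by
  induction a using DirectSum.Decomposition.inductionOn (X.gr U) with
  | zero => simp
  | add a b ha hb => simp only [map_add, Pi.add_apply, ha, hb]
  | @homogeneous n a =>
    rcases eq_or_ne n w with rfl | hn
    · rw [proj_apply, DirectSum.decompose_of_mem_same _ a.2]
      refine projZeroRingHom_of_mem ?_
      obtain h0 | ⟨j, hj, hmem⟩ := X.xi_degree a.2 i
      · exact h0 ▸ zero_mem _
      · rwa [show j = 0 by omega] at hmem
    · rw [proj_apply, DirectSum.decompose_of_mem_ne _ a.2 hn, map_zero, Pi.zero_apply]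
      obtain h0 | ⟨j, hj, hmem⟩ := X.xi_degree a.2 i
      · rw [h0, map_zero]
      · exact DirectSum.decompose_of_mem_ne _ hmem (by omega)

theorem projZeroRingHom_mem_Fit {U : X.S.affineOpens} {m : ℤ} {f : X.A U} (hf : f ∈ X.Fit U m) :
    projZeroRingHom (X.gr U) f ∈ X.Fit U m := by
  rw [Fit_eq_minorIdeal] at hf ⊢
  refine minorIdeal_mono (fun a => ⟨proj (X.gr U) w a, ?_⟩) _
    (map_minorIdeal (projZeroRingHom (X.gr U)) _ _ ▸ Ideal.mem_map_of_mem _ hf)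
  ext i
  exact (X.projZeroRingHom_xi a i).symm

theorem positiveIdeal_eq_ker (U : X.S.affineOpens) :
    X.positiveIdeal U = RingHom.ker (projZeroRingHom (X.gr U)) := by
  rw [← HomogeneousIdeal.toIdeal_irrelevant, HomogeneousIdeal.irrelevant_eq_span, positiveIdeal]
  congr 1
  ext f
  simp

section GradedHom

variable {X} {X' : GradedCone k r w} {U : X.S.affineOpens} {U' : X'.S.affineOpens}

theorem xi_map {φ : X.A U →+* X'.A U'}
    (hco : ∀ f, X'.coact U' (φ f) = MvPolynomial.map φ (X.coact U f)) (f : X.A U) (i : Fin r) :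
    X'.xi U' (φ f) i = φ (X.xi U f i) := by
  rw [xi_apply, hco, MvPolynomial.coeff_map, xi_apply]

theorem map_Fit_le {φ : X.A U →+* X'.A U'}
    (hco : ∀ f, X'.coact U' (φ f) = MvPolynomial.map φ (X.coact U f)) (m : ℤ) :
    (X.Fit U m).map φ ≤ X'.Fit U' m := by
  rw [Fit_eq_minorIdeal, Fit_eq_minorIdeal, map_minorIdeal]
  exact minorIdeal_mono (fun a => ⟨φ a, funext (xi_map hco a)⟩) _

theorem degreeSet_Fit_eq_of_injective {φ : X.gr U →+*ᵍ X'.gr U'} (hφ : Function.Injective φ)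
    (hco : ∀ f, X'.coact U' (φ f) = MvPolynomial.map φ.toRingHom (X.coact U f))
    {c : X.A U} (hc : c ∈ X.gr U 0) (hc0 : c ≠ 0)
    (hfrac : ∀ a, ∃ (n : ℕ) (b : X.A U), φ c ^ n * a = φ b) (m : ℤ) :
    degreeSet (X'.gr U') (X'.Fit U' m) = degreeSet (X.gr U) (X.Fit U m) := by
  have := nonempty_of_ne_zero ((map_ne_zero_iff φ hφ).2 hc0)
  refine degreeSet_eq_of_injective hφ hc hc0 (map_Fit_le hco m) fun x hx => ?_
  rw [Fit_eq_minorIdeal] at hx ⊢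
  refine exists_pow_mul_eq_map_of_mem_minorIdeal (φ := φ.toRingHom) hfrac (fun a => ?_) hx
  obtain ⟨n, b, hb⟩ := hfrac a
  have hcn : φ c ^ n ∈ X'.gr U' 0 := by simpa using SetLike.pow_mem_graded n (φ.map_mem hc)
  refine ⟨n, b, fun i => ?_⟩
  have hxi := congrFun (X'.xi_mul_of_mem_gr_zero hcn a) i
  rw [hb] at hxi
  exact hxi.symm.trans (xi_map hco b i)

end GradedHom

section Restriction

variable {U V : X.S.affineOpens}

/-- Restriction of functions on `C` to a smaller affine open of `S`. -/
def res (h : V.1 ≤ U.1) : X.gr U →+*ᵍ X.gr V where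
  toRingHom := (X.C.presheaf.map (homOfLE (X.π.preimage_mono h)).op).hom
  map_mem := X.map_mem_gr _

theorem coact_res (h : V.1 ≤ U.1) (f : X.A U) :
    X.coact V (X.res h f) = MvPolynomial.map (X.res h).toRingHom (X.coact U f) :=
  X.coact_map _ f

theorem xi_res (h : V.1 ≤ U.1) (f : X.A U) (i : Fin r) :
    X.xi V (X.res h f) i = X.res h (X.xi U f i) :=
  xi_map (X.coact_res h) f i

theorem res_injective (h : V.1 ≤ U.1) [Nonempty V.1] : Function.Injective (X.res h) :=
  map_injective_of_isIntegral X.C (homOfLE (X.π.preimage_mono h))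

theorem basicOpen_res (h : V.1 ≤ U.1) (f : X.A U) :
    X.C.basicOpen (X.res h f) = X.π ⁻¹ᵁ V.1 ⊓ X.C.basicOpen f :=
  X.C.basicOpen_res f _

theorem res_const (h : V.1 ≤ U.1) (c : k) : X.res h (X.const U c) = X.const V c := by
  have hcomp : ((Scheme.ΓSpecIso (CommRingCat.of k)).inv ≫
      (X.π ≫ X.str).appLE ⊤ (X.π ⁻¹ᵁ U.1) (by simp)) ≫
        X.C.presheaf.map (homOfLE (X.π.preimage_mono h)).op =
      (Scheme.ΓSpecIso (CommRingCat.of k)).inv ≫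
        (X.π ≫ X.str).appLE ⊤ (X.π ⁻¹ᵁ V.1) (by simp) := by
    rw [Category.assoc]
    exact congrArg (_ ≫ ·) (Scheme.Hom.appLE_map (X.π ≫ X.str) (U := ⊤) (V := X.π ⁻¹ᵁ U.1)
      (fun _ _ => trivial) _)
  exact congr($(hcomp).hom c)

theorem affineBasicOpen_le (g : Γ(X.S, U.1)) : (X.S.affineBasicOpen g).1 ≤ U.1 :=
  X.S.basicOpen_le g

theorem isUnit_res_app (g : Γ(X.S, U.1)) :
    IsUnit (X.res (X.affineBasicOpen_le g) ((X.π.app U.1).hom g)) := by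
  have hnat := X.π.naturality (homOfLE (X.affineBasicOpen_le g)).op
  have hunit := (RingedSpace.isUnit_res_basicOpen X.S.toRingedSpace g).map
    (X.π.app (X.S.affineBasicOpen g).1).hom
  exact Eq.mp (congrArg IsUnit congr($(hnat).hom g)) hunit

theorem exists_pow_mul_eq_res (g : Γ(X.S, U.1)) (a : X.A (X.S.affineBasicOpen g)) :
    ∃ (n : ℕ) (b : X.A U), X.res (X.affineBasicOpen_le g) ((X.π.app U.1).hom g) ^ n * a =
      X.res (X.affineBasicOpen_le g) b := by
  let : Algebra (X.A U) (X.A (X.S.affineBasicOpen g)) :=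
    (X.res (X.affineBasicOpen_le g)).toRingHom.toAlgebra
  have : IsLocalization.Away ((X.π.app U.1).hom g) (X.A (X.S.affineBasicOpen g)) :=
    (X.isAffineOpen_preimage U).isLocalization_of_eq_basicOpen _
      (homOfLE (X.π.preimage_mono (X.affineBasicOpen_le g))) (Scheme.preimage_basicOpen X.π g)
  obtain ⟨n, b, h⟩ := IsLocalization.Away.surj ((X.π.app U.1).hom g) a
  exact ⟨n, b, (mul_comm _ _).trans h⟩

theorem degreeSet_Fit_eq (U U' : X.S.affineOpens) [hU : Nonempty U.1] [hU' : Nonempty U'.1]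
    (m : ℤ) : degreeSet (X.gr U) (X.Fit U m) = degreeSet (X.gr U') (X.Fit U' m) := by
  obtain ⟨x, hx, hx'⟩ := nonempty_preirreducible_inter U.1.2 U'.1.2
    (Set.nonempty_coe_sort.1 hU) (Set.nonempty_coe_sort.1 hU')
  refine eq_of_eq_affineBasicOpen (fun V _ => degreeSet (X.gr V) (X.Fit V m))
    (fun V g hg => ?_) U U' hx hx'
  have : Nonempty (X.S.affineBasicOpen g).1 := ⟨⟨x, hg⟩⟩
  refine degreeSet_Fit_eq_of_injective (X.res_injective (X.affineBasicOpen_le g)) (X.coact_res _)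
    (X.app_mem_gr_zero g) (fun h0 => ?_) (X.exists_pow_mul_eq_res g) m
  exact (X.isUnit_res_app g).ne_zero (by rw [h0, map_zero])

theorem forall_mem_zeroLocus_iff_of_res_mem {s : ∀ U : X.S.affineOpens, Set (X.A U)}
    (hres : ∀ {U V : X.S.affineOpens} (h : V.1 ≤ U.1), ∀ f ∈ s U, X.res h f ∈ s V)
    (hfrac : ∀ {U : X.S.affineOpens} (g : Γ(X.S, U.1)), ∀ f ∈ s (X.S.affineBasicOpen g),
      ∃ n : ℕ, ∃ b ∈ s U,
        X.res (X.affineBasicOpen_le g) ((X.π.app U.1).hom g) ^ n * f =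
          X.res (X.affineBasicOpen_le g) b)
    {x : X.C} (U : X.S.affineOpens) (hx : x ∈ X.π ⁻¹ᵁ U.1) :
    (∀ V : X.S.affineOpens, x ∈ X.π ⁻¹ᵁ V.1 → x ∈ X.C.zeroLocus (s V)) ↔
      x ∈ X.C.zeroLocus (s U) := by
  refine ⟨fun H => H U hx, fun H U' hx' => Eq.mp (eq_of_eq_affineBasicOpen (x := X.π x)
    (fun V _ => x ∈ X.C.zeroLocus (s V)) (fun V g hg => propext ?_) U U' hx hx') H⟩
  simp only [Scheme.mem_zeroLocus_iff]
  refine ⟨fun H f hf hxf => ?_, fun H f hf hxf => ?_⟩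
  · exact H _ (hres (X.affineBasicOpen_le g) f hf) ((X.basicOpen_res _ f).ge ⟨hg, hxf⟩)
  · obtain ⟨n, b, hb, h⟩ := hfrac g f hf
    have hxb : x ∈ X.C.basicOpen (X.res (X.affineBasicOpen_le g) b) := by
      rw [← h, Scheme.basicOpen_mul, X.C.basicOpen_of_isUnit ((X.isUnit_res_app g).pow n)]
      exact ⟨hg, hxf⟩
    exact H b hb ((X.basicOpen_res _ b).le hxb).2

end Restriction

section Points

variable {U : X.S.affineOpens} {x : X.C}

theorem mem_zeroSection_iff (hx : x ∈ X.π ⁻¹ᵁ U.1) :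
    x ∈ X.zeroSection ↔ x ∈ X.C.zeroLocus (X.positiveIdeal U : Set (X.A U)) := by
  rw [positiveIdeal, Scheme.zeroLocus_span, ← X.forall_mem_zeroLocus_iff_of_res_mem
    (s := fun V => {f | ∃ n : ℕ, 0 < n ∧ f ∈ X.gr V n}) ?_ ?_ U hx]
  · refine forall₂_congr fun V hV => ?_
    rw [← Scheme.zeroLocus_span, Scheme.mem_zeroLocus_iff]
    simp only [Scheme.evaluation_eq_zero_iff_notMem_basicOpen]
    rfl
  · exact fun h f ⟨n, hn, hf⟩ => ⟨n, hn, (X.res h).map_mem hf⟩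
  · rintro V g f ⟨n, hn, hf⟩
    obtain ⟨N, b, h⟩ := X.exists_pow_mul_eq_res g f
    obtain ⟨b', hb', h'⟩ := exists_mem_pow_projZeroRingHom_mul_eq h hf
    rw [projZeroRingHom_of_mem (X.app_mem_gr_zero g)] at h'
    exact ⟨N, b', ⟨n, hn, hb'⟩, h'⟩

/-- The action of the vector field `∑ c_i ξ_i` in `𝔲 = k^r` on functions. -/
noncomputable def vectorField (U : X.S.affineOpens) (c : Fin r → k) (f : X.A U) : X.A U :=
  ∑ i, X.const U (c i) * X.xi U f i

theorem res_vectorField {V : X.S.affineOpens} (h : V.1 ≤ U.1) (c : Fin r → k) (f : X.A U) :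
    X.res h (X.vectorField U c f) = X.vectorField V c (X.res h f) := by
  simp only [vectorField, map_sum, map_mul, res_const, xi_res]

theorem vectorField_mul_of_mem_gr_zero (c : Fin r → k) {a : X.A U} (ha : a ∈ X.gr U 0)
    (f : X.A U) : X.vectorField U c (a * f) = a * X.vectorField U c f := by
  rw [vectorField, vectorField, X.xi_mul_of_mem_gr_zero ha, Finset.mul_sum]
  exact Finset.sum_congr rfl fun i _ => mul_left_comm _ _ _

theorem mem_stab_iff (hx : x ∈ X.π ⁻¹ᵁ U.1) {c : Fin r → k} :
    c ∈ X.stab x ↔ x ∈ X.C.zeroLocus (Set.range (X.vectorField U c)) := by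
  rw [← X.forall_mem_zeroLocus_iff_of_res_mem (s := fun V => Set.range (X.vectorField V c))
    ?_ ?_ U hx]
  · refine forall₂_congr fun V hV => ?_
    simp only [Scheme.evaluation_eq_zero_iff_notMem_basicOpen, Scheme.mem_zeroLocus_iff,
      Set.forall_mem_range]
    rfl
  · rintro V V' h _ ⟨f, rfl⟩
    exact ⟨X.res h f, (X.res_vectorField h c f).symm⟩
  · rintro V g _ ⟨f, rfl⟩
    obtain ⟨N, b, h⟩ := X.exists_pow_mul_eq_res g f
    refine ⟨N, _, ⟨b, rfl⟩, ?_⟩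
    rw [res_vectorField, ← h, ← map_pow, ← map_pow, vectorField_mul_of_mem_gr_zero]
    exact (X.res _).map_mem (X.app_mem_gr_zero (g ^ N))

theorem finrank_stab_le_iff [IsAlgClosed k] (hx : x ∈ X.π ⁻¹ᵁ U.1) (hcl : IsClosed {x}) (m : ℕ) :
    Module.finrank k (X.stab x) ≤ m ↔ ∃ f ∈ X.Fit U m, x ∈ X.C.basicOpen f := by
  obtain ⟨φ, hφ, hconst⟩ := exists_ringHom_of_isClosed_singleton (X.π ≫ X.str) hx hcl
  let M : Matrix (X.A U) (Fin r) k := (Matrix.of (X.xi U)).map φ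
  have hstab : ∀ c, c ∈ X.stab x ↔ ∀ f, M f ⬝ᵥ c = 0 := fun c => by
    rw [X.mem_stab_iff hx, Scheme.mem_zeroLocus_iff, Set.forall_mem_range]
    refine forall_congr' fun f => ?_
    have hconst (a : k) : φ (X.const U a) = a := hconst a
    rw [← hφ, not_not, vectorField, map_sum, dotProduct_comm]
    simp only [map_mul, hconst]
    rfl
  have hrank := finrank_span_row_add_finrank_eq_card M (X.stab x) hstab
  rw [Fintype.card_fin] at hrank
  have hFit : minorIdeal M ((r : ℤ) - m).toNat ≠ ⊥ ↔ ∃ f ∈ X.Fit U m, x ∈ X.C.basicOpen f := by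
    rw [Fit_eq_minorIdeal, ← map_minorIdeal, ne_eq, Ideal.map_eq_bot_iff_le_ker,
      SetLike.not_le_iff_exists]
    simp only [RingHom.mem_ker, hφ]
  rw [← hFit, minorIdeal_ne_bot_iff]
  omega

theorem exists_mem_zeroSection_basicOpen {f : X.A U} (hf : f ∈ X.gr U 0) (hf0 : f ≠ 0) :
    ∃ z ∈ X.zeroSection, IsClosed {z} ∧ z ∈ X.C.basicOpen f := by
  have := nonempty_of_ne_zero hf0
  have hrad : f ∉ (X.positiveIdeal U).radical := by
    rw [positiveIdeal_eq_ker, (RingHom.ker_isPrime _).radical, RingHom.mem_ker,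
      projZeroRingHom_of_mem hf]
    exact hf0
  obtain ⟨z, ⟨hzf, hz⟩, hcl⟩ := nonempty_inter_closedPoints
    (basicOpen_inter_zeroLocus_nonempty (X.isAffineOpen_preimage U) hrad)
    ((X.C.basicOpen f).2.isLocallyClosed.inter (X.C.zeroLocus_isClosed _).isLocallyClosed)
  exact ⟨z, (X.mem_zeroSection_iff (X.C.basicOpen_le f hzf)).2 hz, hcl, hzf⟩

variable {X} in
theorem projZeroRingHom_ne_zero_of_mem_basicOpen (hx : x ∈ X.zeroSection) {f : X.A U}
    (hxf : x ∈ X.C.basicOpen f) : projZeroRingHom (X.gr U) f ≠ 0 := fun h0 => by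
  rw [← RingHom.mem_ker, ← positiveIdeal_eq_ker] at h0
  exact (X.C.mem_zeroLocus_iff _ _).1
    ((X.mem_zeroSection_iff (X.C.basicOpen_le f hxf)).1 hx) f h0 hxf

end Points

section Index

theorem exists_finrank_stab_le_iff [IsAlgClosed k] (U : X.S.affineOpens) [Nonempty U.1] (m : ℕ) :
    (∃ z ∈ X.zeroSection, IsClosed {z} ∧ Module.finrank k (X.stab z) ≤ m) ↔
      0 ∈ degreeSet (X.gr U) (X.Fit U m) := by
  constructor
  · rintro ⟨z, hz, hcl, hzm⟩
    obtain ⟨V, hzV, -⟩ := exists_affineOpens_mem_le (U := ⊤) (x := X.π z) trivial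
    have : Nonempty V.1 := ⟨⟨_, hzV⟩⟩
    obtain ⟨f, hf, hzf⟩ := (X.finrank_stab_le_iff hzV hcl m).1 hzm
    rw [X.degreeSet_Fit_eq U V]
    exact ⟨_, X.projZeroRingHom_mem_Fit hf, projZeroRingHom_mem f,
      projZeroRingHom_ne_zero_of_mem_basicOpen hz hzf⟩
  · rintro ⟨f, hf, hf0, hne⟩
    obtain ⟨z, hz, hcl, hzf⟩ := X.exists_mem_zeroSection_basicOpen hf0 hne
    exact ⟨z, hz, hcl, (X.finrank_stab_le_iff (X.C.basicOpen_le f hzf) hcl m).2 ⟨f, hf, hzf⟩⟩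

theorem d_le_iff [IsAlgClosed k] (U : X.S.affineOpens) [Nonempty U.1] (m : ℕ) :
    X.d ≤ m ↔ 0 ∈ degreeSet (X.gr U) (X.Fit U m) := by
  rw [← exists_finrank_stab_le_iff]
  constructor
  · intro h
    obtain ⟨z, hz, hcl, -⟩ :=
      X.exists_mem_zeroSection_basicOpen (SetLike.one_mem_graded (X.gr U)) one_ne_zero
    obtain ⟨z, hz, hcl, hzd⟩ := Nat.sInf_mem (s := {m | ∃ z ∈ X.zeroSection, IsClosed {z} ∧
      m = Module.finrank k (X.stab z)}) ⟨_, z, hz, hcl, rfl⟩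
    exact ⟨z, hz, hcl, hzd.symm.trans_le h⟩
  · rintro ⟨z, hz, hcl, hzm⟩
    have hd : X.d ≤ Module.finrank k (X.stab z) := Nat.sInf_le ⟨z, hz, hcl, rfl⟩
    exact hd.trans hzm

theorem e_eq_sInf_degreeSet (U : X.S.affineOpens) [Nonempty U.1] :
    X.e = sInf (Nat.cast '' degreeSet (X.gr U) (X.Fit U (X.d - 1))) := by
  refine congrArg sInf (Set.ext fun N => ⟨?_, ?_⟩)
  · rintro ⟨n, rfl, V, f, hf, hfn, hf0⟩
    have := nonempty_of_ne_zero hf0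
    exact ⟨n, X.degreeSet_Fit_eq V U _ ▸ ⟨f, hf, hfn, hf0⟩, rfl⟩
  · rintro ⟨n, hn, rfl⟩
    exact ⟨n, rfl, U, hn⟩

variable {X} {X' : GradedCone k r w} {U : X.S.affineOpens} {U' : X'.S.affineOpens}
  [Nonempty U'.1]

theorem index_eq_of_degreeSet_Fit_eq [IsAlgClosed k] [Nonempty U.1]
    (h : ∀ m, degreeSet (X'.gr U') (X'.Fit U' m) = degreeSet (X.gr U) (X.Fit U m)) :
    X'.index = X.index := by
  have hd : X'.d = X.d := eq_of_forall_ge_iff fun m => by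
    rw [X'.d_le_iff U', X.d_le_iff U, h]
  rw [index, index, X'.e_eq_sInf_degreeSet U', X.e_eq_sInf_degreeSet U, h, hd]

theorem degreeSet_Fit_eq_of_isOpenImmersion (p : X'.C ⟶ X.C)
    (h : X'.π ⁻¹ᵁ U'.1 ≤ p ⁻¹ᵁ X.π ⁻¹ᵁ U.1) [IsOpenImmersion ((X'.π ⁻¹ᵁ U'.1).ι ≫ p)]
    (hgr : ∀ n, ∀ f ∈ X.gr U n, (p.appLE _ _ h).hom f ∈ X'.gr U' n)
    (hco : ∀ f, X'.coact U' ((p.appLE _ _ h).hom f) =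
      MvPolynomial.map (p.appLE _ _ h).hom (X.coact U f)) (m : ℤ) :
    degreeSet (X'.gr U') (X'.Fit U' m) = degreeSet (X.gr U) (X.Fit U m) := by
  let φ : X.gr U →+*ᵍ X'.gr U' := { toRingHom := (p.appLE _ _ h).hom, map_mem := hgr _ _ }
  obtain ⟨z, hz, -, hzU⟩ :=
    X'.exists_mem_zeroSection_basicOpen (SetLike.one_mem_graded (X'.gr U')) one_ne_zero
  have hzU := X'.C.basicOpen_le _ hzU
  obtain ⟨c, hc, hzc⟩ := (X.isAffineOpen_preimage U).exists_basicOpen_le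
    (V := ((X'.π ⁻¹ᵁ U'.1).ι ≫ p).opensRange) ⟨p z, ⟨⟨z, hzU⟩, rfl⟩⟩ (h hzU)
  have hzφc : z ∈ X'.C.basicOpen (φ c) := (Scheme.basicOpen_appLE p _ _ h c).ge ⟨hzU, hzc⟩
  have hc0 : φ (projZeroRingHom (X.gr U) c) ≠ 0 := by
    rw [map_projZeroRingHom]
    exact projZeroRingHom_ne_zero_of_mem_basicOpen hz hzφc
  have hφc : (p.appLE _ _ h).hom c ≠ 0 := (basicOpen_nonempty_iff _).1 ⟨z, hzφc⟩
  exact degreeSet_Fit_eq_of_injective (φ := φ) (appLE_injective_of_isOpenImmersion p h) hco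
    (projZeroRingHom_mem c) (fun h0 => hc0 (by rw [h0, map_zero]))
    (exists_pow_projZeroRingHom_mul_eq (φ := φ)
      (exists_pow_mul_eq_appLE p h (X.isAffineOpen_preimage U) hc hφc)) m

end Index

theorem exists_centreI_eq_top [IsAlgClosed k] :
    ∃ U : X.S.affineOpens, Nonempty U.1 ∧ X.centreI U = ⊤ := by
  obtain ⟨U, hxU, -⟩ := exists_affineOpens_mem_le (U := ⊤) (x := Classical.arbitrary X.S) trivial
  have : Nonempty U.1 := ⟨⟨_, hxU⟩⟩
  obtain ⟨f, hf, hf0, hne⟩ := (X.d_le_iff U X.d).1 le_rfl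
  obtain ⟨s, rfl⟩ := (X.mem_gr_zero_iff U f).1 hf0
  have hs : s ≠ 0 := fun h0 => hne (by rw [h0, map_zero])
  have hFit : X.Fit (X.S.affineBasicOpen s) X.d = ⊤ :=
    Ideal.eq_top_of_isUnit_mem _ (map_Fit_le (X.coact_res (X.affineBasicOpen_le s)) X.d
      (Ideal.mem_map_of_mem _ hf)) (X.isUnit_res_app s)
  have hI : X.nonRegIdeal (X.S.affineBasicOpen s) = ⊤ := by rw [nonRegIdeal, hFit, top_sup_eq]
  have := Ideal.Quotient.subsingleton_iff.2 hI
  refine ⟨X.S.affineBasicOpen s, ((basicOpen_nonempty_iff s).2 hs).coe_sort, ?_⟩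
  rw [Ideal.eq_top_iff_one, centreI, RingHom.mem_ker]
  exact Subsingleton.elim _ _

section Blowup

variable (J : (U : X.S.affineOpens) → Ideal (X.A U))

/-- The complement in `C` of the closed subset cut out by the ideal sheaf `J`, over which the
blow-up along `J` is an isomorphism. -/
def coSupport : X.C.Opens := ⨆ (U : X.S.affineOpens) (h : J U), X.C.basicOpen h.1

variable {X J}

theorem mem_coSupport_iff {x : X.C} :
    x ∈ X.coSupport J ↔ ∃ (U : X.S.affineOpens), ∃ h ∈ J U, x ∈ X.C.basicOpen h := by
  simp [coSupport]

theorem preimage_le_coSupport {U : X.S.affineOpens} (hU : J U = ⊤) :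
    X.π ⁻¹ᵁ U.1 ≤ X.coSupport J := fun x hx =>
  mem_coSupport_iff.2 ⟨U, 1, hU ▸ trivial, by rwa [Scheme.basicOpen_one]⟩

theorem pullbackInvertible_of_forall_mem {T : Scheme.{u}} (f : T ⟶ X.C)
    (hf : ∀ t, f t ∈ X.coSupport J) : X.PullbackInvertible J f := by
  intro t
  obtain ⟨U, a, ha, hxa⟩ := mem_coSupport_iff.1 (hf t)
  obtain ⟨V, htV, hVa⟩ := exists_affineOpens_mem_le (U := f ⁻¹ᵁ X.C.basicOpen a) hxa
  have hVU : V.1 ≤ f ⁻¹ᵁ X.π ⁻¹ᵁ U.1 := hVa.trans (f.preimage_mono (X.C.basicOpen_le a))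
  have hunit : IsUnit ((f.appLE _ V.1 hVU).hom a) := by
    rw [← Scheme.Hom.map_appLE f hVa (homOfLE (X.C.basicOpen_le a)).op]
    exact (RingedSpace.isUnit_res_basicOpen X.C.toRingedSpace a).map (f.appLE _ V.1 hVa).hom
  refine ⟨V, U, hVU, 1, htV, one_mem _, ?_⟩
  rw [Ideal.span_singleton_one]
  exact Ideal.eq_top_of_isUnit_mem _ (Ideal.mem_map_of_mem _ ha) hunit

theorem exists_mem_coSupport {T : Scheme.{u}} {f : T ⟶ X.C} (hf : X.PullbackInvertible J f)
    {W : T.Opens} (hW : (W : Set T).Nonempty) : ∃ v ∈ W, f v ∈ X.coSupport J := by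
  obtain ⟨v₀, hv₀⟩ := hW
  obtain ⟨V, U, h, g, hv₀V, hg, hgJ⟩ := hf v₀
  obtain ⟨v, hvg, hvW⟩ :=
    basicOpen_inter_nonempty_of_mem_nonZeroDivisors V.2 hg (W := W) ⟨v₀, hv₀V, hv₀⟩
  refine ⟨v, hvW, ?_⟩
  by_contra hv
  have hvJ : v ∈ T.zeroLocus (U := V.1) ((J U).map (f.appLE _ V.1 h).hom) := by
    rw [Ideal.map, Scheme.zeroLocus_span, Scheme.mem_zeroLocus_iff]
    rintro _ ⟨a, ha, rfl⟩ hva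
    exact hv (mem_coSupport_iff.2 ⟨U, a, ha, ((Scheme.basicOpen_appLE f _ _ h a).le hva).2⟩)
  exact (T.mem_zeroLocus_iff _ _).1 hvJ g (hgJ ▸ Ideal.mem_span_singleton_self g) hvg

theorem IsBlowup.isOpenImmersion {B : Scheme.{u}} {b : B ⟶ X.C} (hb : X.IsBlowup J b) :
    IsOpenImmersion ((b ⁻¹ᵁ X.coSupport J).ι ≫ b) := by
  set O := X.coSupport J
  obtain ⟨g, hg, -⟩ := hb.existsUnique_lift O.ι (pullbackInvertible_of_forall_mem _ fun t => t.2)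
  have hrange : Set.range g ⊆ Set.range (b ⁻¹ᵁ O).ι := by
    rintro _ ⟨t, rfl⟩
    have hbg : b (g t) = t.1 := congr($hg t)
    exact ⟨⟨g t, show b (g t) ∈ O from hbg ▸ t.2⟩, rfl⟩
  have hl := IsOpenImmersion.lift_fac (b ⁻¹ᵁ O).ι g hrange
  set l := IsOpenImmersion.lift (b ⁻¹ᵁ O).ι g hrange
  have hinv : PullbackInvertible X J ((b ⁻¹ᵁ O).ι ≫ b) :=
    pullbackInvertible_of_forall_mem _ fun t => t.2
  have hleft : (b ∣_ O) ≫ l = 𝟙 _ := by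
    rw [← cancel_mono (b ⁻¹ᵁ O).ι, Category.assoc, hl, Category.id_comp]
    refine (hb.existsUnique_lift _ hinv).unique ?_ rfl
    rw [Category.assoc, hg, morphismRestrict_ι]
  have hright : l ≫ (b ∣_ O) = 𝟙 _ := by
    rw [← cancel_mono O.ι, Category.assoc, morphismRestrict_ι, reassoc_of% hl, hg, Category.id_comp]
  have : IsIso (b ∣_ O) := ⟨l, hleft, hright⟩
  rw [← morphismRestrict_ι]
  infer_instance

end Blowup

end GradedCone

namespace Modification

variable {k : Type u} [Field k] {r w : ℕ} {X X' : GradedCone k r w}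
  {J : (U : X.S.affineOpens) → Ideal (X.A U)}

theorem isOpenImmersion_ι_comp (M : Modification X X' J) {V : X'.C.Opens}
    (hV : V ≤ (M.j ≫ M.b) ⁻¹ᵁ X.coSupport J) : IsOpenImmersion (V.ι ≫ M.j ≫ M.b) := by
  have := M.isOpenImmersion
  have := M.isBlowup.isOpenImmersion
  have hrange : Set.range (V.ι ≫ M.j) ⊆ Set.range (M.b ⁻¹ᵁ X.coSupport J).ι := by
    rintro _ ⟨t, rfl⟩
    exact ⟨⟨M.j t.1, hV t.2⟩, rfl⟩
  rw [← Category.assoc, ← IsOpenImmersion.lift_fac (M.b ⁻¹ᵁ X.coSupport J).ι (V.ι ≫ M.j) hrange,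
    Category.assoc]
  infer_instance

theorem exists_mem_preimage (M : Modification X X' J) (U : X.S.affineOpens) [Nonempty U.1] :
    ∃ x, (M.j ≫ M.b) x ∈ X.π ⁻¹ᵁ U.1 := by
  obtain ⟨_, ⟨c, rfl⟩, hc⟩ :=
    GradedCone.exists_mem_coSupport M.isBlowup.invertible M.isOpenStratum.1
  let O := (M.j ≫ M.b) ⁻¹ᵁ X.coSupport J
  have := M.isOpenImmersion_ι_comp (V := O) le_rfl
  obtain ⟨_, ⟨t, rfl⟩, ht⟩ := nonempty_preirreducible_inter (O.ι ≫ M.j ≫ M.b).opensRange.2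
    (X.π ⁻¹ᵁ U.1).2 ⟨_, ⟨c, hc⟩, rfl⟩ (Set.nonempty_coe_sort.1 (X.nonempty_preimage U))
  exact ⟨t.1, ht⟩

theorem exists_preimage_le (M : Modification X X' J) (U : X.S.affineOpens) [Nonempty U.1] :
    ∃ U' : X'.S.affineOpens, Nonempty U'.1 ∧ X'.π ⁻¹ᵁ U'.1 ≤ (M.j ≫ M.b) ⁻¹ᵁ X.π ⁻¹ᵁ U.1 := by
  have hpre : X'.π ⁻¹ᵁ M.q ⁻¹ᵁ U.1 = (M.j ≫ M.b) ⁻¹ᵁ X.π ⁻¹ᵁ U.1 := by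
    rw [← Scheme.Hom.comp_preimage, ← M.comm, Scheme.Hom.comp_preimage]
  obtain ⟨x, hx⟩ := M.exists_mem_preimage U
  obtain ⟨U', hxU', hU'⟩ := exists_affineOpens_mem_le (U := M.q ⁻¹ᵁ U.1) (hpre.ge hx)
  exact ⟨U', ⟨⟨_, hxU'⟩⟩, (X'.π.preimage_mono hU').trans hpre.le⟩

theorem index_eq_of_eq_top [IsAlgClosed k] (M : Modification X X' J) {U : X.S.affineOpens}
    [Nonempty U.1] (hU : J U = ⊤) : X'.index = X.index := by
  obtain ⟨U', _, hle⟩ := M.exists_preimage_le U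
  have := M.isOpenImmersion_ι_comp
    (hle.trans ((M.j ≫ M.b).preimage_mono (GradedCone.preimage_le_coSupport hU)))
  exact GradedCone.index_eq_of_degreeSet_Fit_eq
    (GradedCone.degreeSet_Fit_eq_of_isOpenImmersion (M.j ≫ M.b) hle (M.map_mem_gr U U' hle)
      (M.coact_map U U' hle))

end Modification

end GradedAdditive

theorem corollary4p2_general {k : Type u} [Field k] [IsAlgClosed k] {r w : ℕ}
    {X X' : GradedAdditive.GradedCone k r w} (M : GradedAdditive.Modification X X' X.centreI) :
    X'.index = X.index :=
  have ⟨_, _, hU⟩ := X.exists_centreI_eq_top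
  M.index_eq_of_eq_top hU

theorem corollary4p2 {k : Type u} [Field k] [IsAlgClosed k] [CharZero k] (r w : ℕ)
    (hr : 0 < r) (hw : 0 < w) (X X' : GradedAdditive.GradedCone k r w) (M : GradedAdditive.Modification X X' X.centreI) :
    X'.index ≤ X.index ∧ X'.index = X.index := by
  exact ⟨(corollary4p2_general M).le, corollary4p2_general M⟩
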